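/- Let $q$ be $2$ or $3$, and put $k_0=3$ if $q=2$ and $k_0=2$ if $q=3$. Codes are linear subspaces of $\mathbb F_q^n$; an $[n,k,d]$ code has length $n$, dimension $k$ and minimum nonzero weight $d$. The dual code $C^\perp$ is taken with respect to the standard inner product, $C$ is LCD if $C\cap C^\perp=\{0\}$, and the dual distance of $C$ is the minimum nonzero weight of $C^\perp$ (taken to be $\infty$ if $C^\perp=0$). Two codes $C,C'$ of length $n$ are equivalent if $C'=\{cP \mid c\in C\}$ for some $n\times n$ monomial matrix $P$ over $\mathbb F_q$. Put $[k]_q=\frac{q^k-1}{q-1}$. Let $n,k,d$ be nonnegative integers with $k\ge k_0$, put $r=q^{k-1}n-[k]_q\,d$ and $s=qd-(q-1)n$, and suppose that $s\ge 1$ and $qr\ge k$. Then: (i) There is a one-to-one correspondence between the equivalence classes of LCD $[n,k,d]$ codes over $\mathbb F_q$ with dual distance at least $2$ and the equivalence classes of LCD $[qr,k,(q-1)r]$ codes over $\mathbb F_q$ with dual distance at least $2$. It can be chosen so that the class of $C$ corresponds to the class of $C_0$ if and only if $C_0$ has a generator matrix $G_0$ such that $C$ is equivalent to the code with generator matrix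 $\begin{pmatrix} S_{q,k}^{(s)} & G_0\end{pmatrix}$. Here $S_{q,k}^{(s)}$ is the juxtaposition of $s$ copies of the generator matrix $S_{q,k}$ of the simplex code, i.e. of the $k\times[k]_q$ matrix whose columns are, in some fixed order, all vectors of $\mathbb F_q^k$ whose first nonzero coordinate is $1$. (ii) If there is no LCD $[qr,k,(q-1)r]$ code over $\mathbb F_q$ with dual distance at least $2$, then there is no LCD $[n,k,d]$ code over $\mathbb F_q$ at all. -/

import Mathlib

/-- `[k]_q = (q^k - 1)/(q - 1)`; for `2 ≤ q` the division is exact. -/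
def qNumber (q k : ℕ) : ℕ := (q ^ k - 1) / (q - 1)

/-- The integer `r_{q,n,k,d} = q^(k-1) n - [k]_q d`. -/
def rInt (q n k d : ℕ) : ℤ := (q : ℤ) ^ (k - 1) * n - (qNumber q k : ℤ) * d

namespace LinCode

/-- The dual code with respect to the standard inner product. A code of length `n` is a subspace
of `Fin n → F`; other finite index types for the coordinates are allowed. -/
def dual {F ι : Type*} [Field F] [Fintype ι] (C : Submodule F (ι → F)) :
    Submodule F (ι → F) where
  carrier := {x | ∀ y ∈ C, x ⬝ᵥ y = 0}
  add_mem' := by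
    intro a b ha hb y hy
    rw [add_dotProduct, ha y hy, hb y hy, add_zero]
  zero_mem' := by
    intro y _
    exact zero_dotProduct y
  smul_mem' := by
    intro c x hx y hy
    rw [smul_dotProduct, hx y hy, smul_zero]

/-- The minimum weight of the nonzero codewords; it is `⊤` exactly for the zero code. -/
noncomputable def minWeight {F ι : Type*} [Field F] [DecidableEq F] [Fintype ι]
    (C : Submodule F (ι → F)) : ℕ∞ :=
  ⨅ c ∈ C, ⨅ _ : c ≠ 0, (hammingNorm c : ℕ∞)

/-- The dual distance: the minimum weight of the dual code. -/
noncomputable def dualDistance {F ι : Type*} [Field F] [DecidableEq F] [Fintype ι]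
    (C : Submodule F (ι → F)) : ℕ∞ :=
  minWeight (dual C)

/-- `C` is an LCD `[n, k, d]` code. -/
structure IsLCDCode {F : Type*} [Field F] [DecidableEq F] (n k d : ℕ)
    (C : Submodule F (Fin n → F)) : Prop where
  finrank_eq : Module.finrank F C = k
  minWeight_eq : minWeight C = d
  lcd : C ⊓ dual C = ⊥

/-- A monomial matrix: exactly one nonzero entry in each row and in each column. Rows and columns
may be indexed by different types (necessarily of the same size). -/
def IsMonomial {F ι κ : Type*} [Field F] (P : Matrix ι κ F) : Prop :=
  ∃ σ : ι ≃ κ, ∀ i j, P i j ≠ 0 ↔ σ i = j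

/-- Equivalence of codes: `C₂ = {c P | c ∈ C₁}` for some monomial matrix `P`. -/
def CodeEquiv {F ι κ : Type*} [Field F] [Fintype ι]
    (C₁ : Submodule F (ι → F)) (C₂ : Submodule F (κ → F)) : Prop :=
  ∃ P : Matrix ι κ F, IsMonomial P ∧ C₂ = C₁.map P.vecMulLinear

theorem CodeEquiv.refl {F ι : Type*} [Field F] [Fintype ι] (C : Submodule F (ι → F)) :
    CodeEquiv C C := by
  classical
  refine ⟨1, ⟨Equiv.refl ι, fun i j => ?_⟩, ?_⟩
  · simp [Matrix.one_apply]
  · ext x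
    simp

theorem CodeEquiv.symm {F ι κ : Type*} [Field F] [Fintype ι] [Fintype κ]
    {C₁ : Submodule F (ι → F)} {C₂ : Submodule F (κ → F)} (h : CodeEquiv C₁ C₂) :
    CodeEquiv C₂ C₁ := by
  classical
  obtain ⟨P, ⟨σ, hσ⟩, rfl⟩ := h
  refine ⟨Matrix.of fun j i => (P i j)⁻¹, ⟨σ.symm, fun j i => ?_⟩, ?_⟩
  · rw [Matrix.of_apply, ne_eq, inv_eq_zero, ← ne_eq, hσ, Equiv.symm_apply_eq, eq_comm]
  · have hPQ : P * Matrix.of (fun j i => (P i j)⁻¹) = 1 := by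
      ext i i'
      rw [Matrix.mul_apply, Finset.sum_eq_single (σ i), Matrix.of_apply, Matrix.one_apply]
      · split_ifs with hi
        · subst hi
          exact mul_inv_cancel₀ ((hσ i _).2 rfl)
        · have : P i' (σ i) = 0 := by
            by_contra hne
            exact hi (σ.injective ((hσ _ _).1 hne)).symm
          rw [this, inv_zero, mul_zero]
      · intro j _ hj
        have : P i j = 0 := by
          by_contra hne
          exact hj ((hσ _ _).1 hne).symm
        rw [this, zero_mul]
      · intro hi
        exact absurd (Finset.mem_univ _) hi
    rw [← Submodule.map_comp]
    have : (Matrix.of fun j i => (P i j)⁻¹).vecMulLinear ∘ₗ P.vecMulLinear = LinearMap.id := by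
      apply LinearMap.ext
      intro x
      simp only [LinearMap.comp_apply, Matrix.vecMulLinear_apply, Matrix.vecMul_vecMul, hPQ,
        Matrix.vecMul_one, LinearMap.id_apply]
    rw [this, Submodule.map_id]

theorem CodeEquiv.trans {F ι κ μ : Type*} [Field F] [Fintype ι] [Fintype κ]
    {C₁ : Submodule F (ι → F)} {C₂ : Submodule F (κ → F)} {C₃ : Submodule F (μ → F)}
    (h₁ : CodeEquiv C₁ C₂) (h₂ : CodeEquiv C₂ C₃) : CodeEquiv C₁ C₃ := by
  classical
  obtain ⟨P, ⟨σ, hσ⟩, rfl⟩ := h₁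
  obtain ⟨Q, ⟨τ, hτ⟩, rfl⟩ := h₂
  refine ⟨P * Q, ⟨σ.trans τ, fun i j => ?_⟩, ?_⟩
  · rw [Matrix.mul_apply, Finset.sum_eq_single (σ i)]
    · rw [mul_ne_zero_iff, hσ, hτ]
      simp
    · intro x _ hx
      have : P i x = 0 := by
        by_contra hne
        exact hx ((hσ _ _).1 hne).symm
      rw [this, zero_mul]
    · intro hi
      exact absurd (Finset.mem_univ _) hi
  · rw [← Submodule.map_comp]
    congr 1
    apply LinearMap.ext
    intro x
    simp [Matrix.vecMul_vecMul]

/-- The LCD `[n, k, d]` codes over `F` with dual distance at least 2. -/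
def LCDCode (F : Type*) [Field F] [DecidableEq F] (n k d : ℕ) : Type _ :=
  {C : Submodule F (Fin n → F) // IsLCDCode n k d C ∧ 2 ≤ dualDistance C}

/-- Equivalence of codes on the LCD `[n, k, d]` codes with dual distance at least 2. -/
instance lcdSetoid (F : Type*) [Field F] [DecidableEq F] (n k d : ℕ) :
    Setoid (LCDCode F n k d) where
  r C₁ C₂ := CodeEquiv C₁.1 C₂.1
  iseqv := ⟨fun C => CodeEquiv.refl C.1, fun h => CodeEquiv.symm h,
    fun h₁ h₂ => CodeEquiv.trans h₁ h₂⟩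

/-- Equivalence classes of LCD `[n, k, d]` codes over `F` with dual distance at least 2. -/
def LCDClass (F : Type*) [Field F] [DecidableEq F] (n k d : ℕ) : Type _ :=
  Quotient (lcdSetoid F n k d)

/-- The equivalence class of a code. -/
def LCDCode.toClass {F : Type*} [Field F] [DecidableEq F] {n k d : ℕ} (C : LCDCode F n k d) :
    LCDClass F n k d :=
  Quotient.mk (lcdSetoid F n k d) C

/-- `G` is a generator matrix of `C`: its rows are a basis of `C`. -/
def IsGeneratorMatrix {F ι : Type*} [Field F] {k : ℕ} (G : Matrix (Fin k) ι F)
    (C : Submodule F (ι → F)) : Prop :=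
  LinearIndependent F G.row ∧ Submodule.span F (Set.range G.row) = C

/-- The columns of the generator matrix `S_{q,k}` of the simplex code: the vectors whose first
nonzero coordinate is `1`, that is, one representative of each one-dimensional subspace of
`F^k`. The order of the columns plays no role up to equivalence, so they index themselves. -/
def SimplexColumn (F : Type*) [Field F] (k : ℕ) : Type _ :=
  {v : Fin k → F // ∃ i, v i = 1 ∧ ∀ j < i, v j = 0}

/-- The generator matrix `S_{q,k}` of the simplex code. -/
def simplexMatrix (F : Type*) [Field F] (k : ℕ) : Matrix (Fin k) (SimplexColumn F k) F :=
  Matrix.of fun i v => v.1 i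

/-- `A^(s)`: the juxtaposition of `s` copies of `A`. -/
def copies {F ι : Type*} {k : ℕ} (s : ℕ) (A : Matrix (Fin k) ι F) :
    Matrix (Fin k) (Fin s × ι) F :=
  Matrix.of fun i x => A i x.2

end LinCode

/-! Up to equivalence, a code is a multiset of points of `F^k` up to scalars (the columns of a
generator matrix), taken modulo `GL_k`. Over fields with 2 or 3 elements every unit squares to 1, so
the Gram matrix `G * Gᵀ`, whose invertibility is the LCD property, depends only on that multiset.

The simplex code has constant weight `q^(k-1)`, and it is self-orthogonal because `2 < (q-1)k`
(`gram_copies`). Adding or removing `s` copies thus keeps the Gram matrix and shifts all nonzero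
weights by `s q^(k-1)`. Removal is possible by an averaging argument (`le_columnMult`): without zero
columns, every point occurs at least `qd - (q-1)n = s` times. Invertible matrices fix the simplex
multiset, so multiplicities cancel and equivalence is preserved both ways
(`codeEquiv_fromCols_copies_iff`). This gives (i).

For (ii), let `G` have `z` zero columns. Averaging now gives every point multiplicity at least `s +
(q-1)z`. Besides `s` simplex copies, remove the zero columns and `(q-1)z` further copies, which is
`z q^k` columns in all. Replace these by `z q^k` columns on an affine hyperplane missing the origin,
each point repeated `qz` times. The new block is self-orthogonal and no word loses weight. The
hyperplane can be chosen so that a given minimum weight word gains none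
(`exists_lcdCode_of_isLCDGenerator`). -/

open Matrix

namespace LinCode

/-! ### Matrices as multisets of columns up to scalars -/

section Columns

variable {F : Type*} [Field F] {k : ℕ} {ι κ : Type*}

/-- Vectors of `F^k` up to nonzero scalars. -/
abbrev ColumnClass (F : Type*) [Field F] (k : ℕ) : Type _ :=
  MulAction.orbitRel.Quotient Fˣ (Fin k → F)

/-- The class of a vector up to nonzero scalars. -/
def columnClass (v : Fin k → F) : ColumnClass F k :=
  Quotient.mk (MulAction.orbitRel Fˣ (Fin k → F)) v

theorem columnClass_eq_iff {v w : Fin k → F} :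
    columnClass v = columnClass w ↔ ∃ c : Fˣ, c • w = v :=
  Quotient.eq.trans MulAction.orbitRel_apply

theorem columnClass_eq_zero_iff {v : Fin k → F} :
    columnClass v = columnClass (0 : Fin k → F) ↔ v = 0 := by
  rw [columnClass_eq_iff]
  constructor
  · rintro ⟨c, rfl⟩
    exact smul_zero c
  · rintro rfl
    exact ⟨1, smul_zero 1⟩

theorem columnClass_surjective : Function.Surjective (columnClass (F := F) (k := k)) :=
  Quotient.mk_surjective

/-- The number of columns of `G` in a given class. -/
noncomputable def columnMult (G : Matrix (Fin k) ι F) (x : ColumnClass F k) : ℕ :=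
  Nat.card {i // columnClass (G.col i) = x}

/-- The columns of `G` and `H` agree up to order and nonzero scalars. -/
def ColumnEquiv (G : Matrix (Fin k) ι F) (H : Matrix (Fin k) κ F) : Prop :=
  ∃ σ : ι ≃ κ, ∀ i, ∃ c : Fˣ, H.col (σ i) = c • G.col i

/-- Bijections between corresponding fibres of `columnClass` glue to a bijection of the index types.
This turns equivalence into equality of counting functions, where a common summand can be cancelled.
-/
theorem columnEquiv_iff_columnMult [Finite ι] [Finite κ]
    {G : Matrix (Fin k) ι F} {H : Matrix (Fin k) κ F} :
    ColumnEquiv G H ↔ ∀ x, columnMult G x = columnMult H x := by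
  constructor
  · rintro ⟨σ, hσ⟩ x
    refine Nat.card_congr (σ.subtypeEquiv fun i => ?_)
    obtain ⟨c, hc⟩ := hσ i
    rw [← columnClass_eq_iff.2 ⟨c, hc.symm⟩]
  · intro h
    let e (x : ColumnClass F k) :
        {i // columnClass (G.col i) = x} ≃ {j // columnClass (H.col j) = x} :=
      (Finite.card_eq.1 (h x)).some
    refine ⟨((Equiv.sigmaFiberEquiv fun i => columnClass (G.col i)).symm.trans
      (Equiv.sigmaCongrRight e)).trans (Equiv.sigmaFiberEquiv fun j => columnClass (H.col j)),
      fun i => ?_⟩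
    obtain ⟨c, hc⟩ := columnClass_eq_iff.1 (e _ ⟨i, rfl⟩).2
    exact ⟨c, hc.symm⟩

theorem columnEquiv_iff_exists_monomial [Fintype ι]
    {G : Matrix (Fin k) ι F} {H : Matrix (Fin k) κ F} :
    ColumnEquiv G H ↔ ∃ P : Matrix ι κ F, IsMonomial P ∧ H = G * P := by
  classical
  constructor
  · rintro ⟨σ, hσ⟩
    choose c hc using hσ
    refine ⟨Matrix.of fun i j => if σ i = j then (c i : F) else 0, ⟨σ, fun i j => ?_⟩, ?_⟩
    · by_cases h : σ i = j <;> simp [h]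
    · ext a j
      obtain ⟨i, rfl⟩ := σ.surjective j
      have := congrFun (hc i) a
      simp only [Matrix.col_apply, Pi.smul_apply, Units.smul_def, smul_eq_mul] at this
      simp [Matrix.mul_apply, this, mul_comm]
  · rintro ⟨P, ⟨σ, hσ⟩, rfl⟩
    refine ⟨σ, fun i => ⟨Units.mk0 (P i (σ i)) ((hσ i _).2 rfl), ?_⟩⟩
    ext a
    simp only [Matrix.col_apply, Pi.smul_apply, Units.smul_def, smul_eq_mul, Units.val_mk0]
    rw [Matrix.mul_apply, Finset.sum_eq_single i, mul_comm]
    · intro i' _ hi'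
      have : P i' (σ i) = 0 := by
        by_contra hne
        exact hi' (σ.injective ((hσ _ _).1 hne))
      rw [this, mul_zero]
    · intro hi
      exact absurd (Finset.mem_univ _) hi

theorem columnMult_fromCols [Finite ι] [Finite κ] (G : Matrix (Fin k) ι F)
    (H : Matrix (Fin k) κ F) (x : ColumnClass F k) :
    columnMult (Matrix.fromCols G H) x = columnMult G x + columnMult H x := by
  unfold columnMult
  rw [← Nat.card_sum]
  exact Nat.card_congr (Equiv.subtypeSum)

theorem sum_columnMult [Fintype F] [Fintype (ColumnClass F k)] [Finite ι]
    (G : Matrix (Fin k) ι F) : ∑ x, columnMult G x = Nat.card ι := by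
  unfold columnMult
  rw [← Nat.card_sigma]
  exact Nat.card_congr (Equiv.sigmaFiberEquiv _)

/-- A submultiset of the columns of `G`, up to scalars, has a complement. -/
theorem exists_complement_columns [Fintype F] [Finite ι] [Finite κ]
    {G : Matrix (Fin k) ι F} {H : Matrix (Fin k) κ F}
    (h : ∀ x, columnMult H x ≤ columnMult G x) :
    ∃ (m : ℕ) (E : Matrix (Fin k) (Fin m) F), Nat.card ι = Nat.card κ + m ∧
      ∀ x, columnMult G x = columnMult H x + columnMult E x := by
  classical
  let _ : Fintype (ColumnClass F k) := Fintype.ofFinite _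
  let T := Σ x : ColumnClass F k, Fin (columnMult G x - columnMult H x)
  have hT : Nat.card ι = Nat.card κ + Nat.card T := by
    have h1 := sum_columnMult G
    have h2 := sum_columnMult H
    have h3 : ∑ x, (columnMult G x - columnMult H x) + ∑ x, columnMult H x =
        ∑ x, columnMult G x := by
      rw [← Finset.sum_add_distrib]
      exact Finset.sum_congr rfl fun x _ => Nat.sub_add_cancel (h x)
    rw [Nat.card_sigma]
    simp only [Nat.card_eq_fintype_card, Fintype.card_fin] at *
    omega
  let e : Fin (Nat.card T) ≃ T := (Finite.equivFin T).symm
  -- Each class contributes one chosen representative, repeated as often as the multiplicities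
  -- differ.
  refine ⟨_, Matrix.of fun a i => (Function.surjInv columnClass_surjective (e i).1) a, hT, fun x => ?_⟩
  rw [← Nat.sub_eq_iff_eq_add' (h x)]
  have hcol (i : Fin (Nat.card T)) : columnClass ((Matrix.of fun a i =>
      (Function.surjInv (columnClass_surjective (F := F) (k := k)) (e i).1) a).col i) = (e i).1 :=
    Function.surjInv_eq columnClass_surjective _
  symm
  calc Nat.card {i // columnClass _ = x}
      = Nat.card {i // (e i).1 = x} := by simp only [hcol]
    _ = Nat.card {t : T // t.1 = x} := Nat.card_congr (e.subtypeEquiv fun i => Iff.rfl)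
    _ = Nat.card (Fin (columnMult G x - columnMult H x)) := Nat.card_congr (Equiv.sigmaSubtype x)
    _ = _ := Nat.card_fin _

theorem columnMult_zero_eq_zero_iff [Finite ι] {G : Matrix (Fin k) ι F} :
    columnMult G (columnClass 0) = 0 ↔ ∀ i, G.col i ≠ 0 := by
  simp only [columnMult, columnClass_eq_zero_iff, Finite.card_eq_zero_iff, isEmpty_subtype]

end Columns

/-! ### Generator matrices, equivalence and the Gram criterion -/

section Generator

variable {F : Type*} [Field F] {k : ℕ} {ι κ : Type*}

theorem exists_isGeneratorMatrix [Finite ι] {C : Submodule F (ι → F)}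
    (h : Module.finrank F C = k) : ∃ G : Matrix (Fin k) ι F, IsGeneratorMatrix G C := by
  let b := Module.finBasisOfFinrankEq F C h
  refine ⟨fun i => b i, ?_, ?_⟩
  · exact b.linearIndependent.map' C.subtype C.ker_subtype
  · have : Set.range (Matrix.row (fun i => (b i : ι → F))) = C.subtype '' Set.range b := by
      rw [← Set.range_comp]
      rfl
    rw [this, ← Submodule.map_span, b.span_eq, Submodule.map_top, Submodule.range_subtype]

theorem mem_iff_of_isGeneratorMatrix {G : Matrix (Fin k) ι F} {C : Submodule F (ι → F)}
    (h : IsGeneratorMatrix G C) {x : ι → F} : x ∈ C ↔ ∃ a, a ᵥ* G = x := by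
  rw [← h.2, Submodule.mem_span_range_iff_exists_fun]
  simp only [Matrix.vecMul_eq_sum]
  rfl

theorem IsGeneratorMatrix.vecMul_injective {G : Matrix (Fin k) ι F} {C : Submodule F (ι → F)}
    (h : IsGeneratorMatrix G C) : Function.Injective fun a => a ᵥ* G :=
  Matrix.vecMul_injective_iff.2 h.1

theorem isGeneratorMatrix_of_injective {G : Matrix (Fin k) ι F}
    (h : Function.Injective fun a => a ᵥ* G) :
    IsGeneratorMatrix G (Submodule.span F (Set.range G.row)) :=
  ⟨Matrix.vecMul_injective_iff.1 h, rfl⟩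

/-- The monomial matrix acts on columns, and `A` is the change of basis between the two generator
matrices. -/
theorem codeEquiv_iff_exists_columnEquiv [Fintype ι]
    {G : Matrix (Fin k) ι F} {H : Matrix (Fin k) κ F} {C : Submodule F (ι → F)}
    {D : Submodule F (κ → F)} (hG : IsGeneratorMatrix G C) (hH : IsGeneratorMatrix H D) :
    CodeEquiv C D ↔ ∃ A : Matrix (Fin k) (Fin k) F, IsUnit A ∧ ColumnEquiv (A * G) H := by
  simp only [columnEquiv_iff_exists_monomial]
  constructor
  · rintro ⟨P, hP, rfl⟩
    have hrow (i : Fin k) : ∃ a, a ᵥ* (G * P) = H.row i := by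
      have hi : H.row i ∈ C.map P.vecMulLinear :=
        hH.2 ▸ Submodule.subset_span (Set.mem_range_self i)
      obtain ⟨y, hy, hyi⟩ := hi
      obtain ⟨a, rfl⟩ := (mem_iff_of_isGeneratorMatrix hG).1 hy
      exact ⟨a, by rw [← hyi, Matrix.vecMulLinear_apply, Matrix.vecMul_vecMul]⟩
    choose A' hA using hrow
    let A : Matrix (Fin k) (Fin k) F := Matrix.of A'
    have hAH : H = A * G * P := by
      ext i j
      rw [Matrix.mul_assoc, Matrix.mul_apply_eq_vecMul]
      exact (congrFun (hA i) j).symm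
    refine ⟨A, ?_, P, hP, hAH⟩
    rw [← Matrix.vecMul_injective_iff_isUnit]
    intro a b hab
    apply hH.vecMul_injective
    have hab' : a ᵥ* A = b ᵥ* A := hab
    change a ᵥ* H = b ᵥ* H
    rw [hAH, Matrix.mul_assoc, ← Matrix.vecMul_vecMul, hab', Matrix.vecMul_vecMul]
  · rintro ⟨A, hA, P, hP, rfl⟩
    refine ⟨P, hP, ?_⟩
    ext x
    rw [mem_iff_of_isGeneratorMatrix hH, Submodule.mem_map]
    constructor
    · rintro ⟨a, rfl⟩
      refine ⟨a ᵥ* A ᵥ* G, (mem_iff_of_isGeneratorMatrix hG).2 ⟨_, rfl⟩, ?_⟩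
      simp [Matrix.vecMul_vecMul, Matrix.mul_assoc]
    · rintro ⟨y, hy, rfl⟩
      obtain ⟨b, rfl⟩ := (mem_iff_of_isGeneratorMatrix hG).1 hy
      obtain ⟨a, rfl⟩ := Matrix.vecMul_surjective_iff_isUnit.2 hA b
      refine ⟨a, ?_⟩
      simp [Matrix.vecMul_vecMul, Matrix.mul_assoc]

theorem vecMul_injective_of_isUnit_gram [Fintype ι] {G : Matrix (Fin k) ι F} (h : IsUnit (G * Gᵀ)) :
    Function.Injective fun a => a ᵥ* G := by
  intro a b hab
  apply Matrix.vecMul_injective_iff_isUnit.2 h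
  change a ᵥ* (G * Gᵀ) = b ᵥ* (G * Gᵀ)
  rw [← Matrix.vecMul_vecMul, ← Matrix.vecMul_vecMul]
  exact congrArg (· ᵥ* Gᵀ) hab

/-- A word `a ᵥ* G` is orthogonal to the whole code exactly when `a` lies in the left kernel of the
Gram matrix. -/
theorem inf_dual_eq_bot_iff [Fintype ι] {G : Matrix (Fin k) ι F} {C : Submodule F (ι → F)}
    (h : IsGeneratorMatrix G C) : C ⊓ dual C = ⊥ ↔ IsUnit (G * Gᵀ) := by
  have key (a : Fin k → F) : a ᵥ* G ∈ dual C ↔ a ᵥ* (G * Gᵀ) = 0 := by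
    have h1 : a ᵥ* G ∈ dual C ↔ ∀ b, (a ᵥ* G) ⬝ᵥ (b ᵥ* G) = 0 := by
      constructor
      · intro ha b
        exact ha _ ((mem_iff_of_isGeneratorMatrix h).2 ⟨b, rfl⟩)
      · intro ha y hy
        obtain ⟨b, rfl⟩ := (mem_iff_of_isGeneratorMatrix h).1 hy
        exact ha b
    have h2 (b : Fin k → F) : (a ᵥ* G) ⬝ᵥ (b ᵥ* G) = (a ᵥ* (G * Gᵀ)) ⬝ᵥ b := by
      rw [← Matrix.vecMul_vecMul, ← Matrix.dotProduct_mulVec (a ᵥ* G), Matrix.mulVec_transpose]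
    simp only [h1, h2]
    exact dotProduct_eq_zero_iff
  rw [← Matrix.vecMul_injective_iff_isUnit, Submodule.eq_bot_iff]
  constructor
  · intro hC
    refine (injective_iff_map_eq_zero (G * Gᵀ).vecMulLinear).2 fun a ha => ?_
    have := hC (a ᵥ* G) ⟨(mem_iff_of_isGeneratorMatrix h).2 ⟨a, rfl⟩, (key a).2 ha⟩
    apply h.vecMul_injective
    simpa using this
  · rintro hinj x ⟨hx, hx'⟩
    obtain ⟨a, rfl⟩ := (mem_iff_of_isGeneratorMatrix h).1 hx
    have : a = 0 := hinj (by simpa using (key a).1 hx')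
    rw [this, Matrix.zero_vecMul]

/-- The Gram matrix is a sum of one rank-one term per column; rescaling the column by `c` multiplies
its term by `c * c = 1`. -/
theorem ColumnEquiv.gram_eq [Fintype ι] {G : Matrix (Fin k) ι F} [Fintype κ] {H : Matrix (Fin k) κ F}
    (hF : ∀ c : Fˣ, (c : F) * c = 1) (h : ColumnEquiv G H) : G * Gᵀ = H * Hᵀ := by
  obtain ⟨σ, hσ⟩ := h
  ext a b
  simp only [Matrix.mul_apply, Matrix.transpose_apply]
  refine Fintype.sum_equiv σ _ _ fun i => ?_
  obtain ⟨c, hc⟩ := hσ i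
  have h1 (a : Fin k) : H a (σ i) = c * G a i := congrFun hc a
  rw [h1, h1, mul_mul_mul_comm, hF, one_mul]

theorem gram_fromCols [Fintype ι] [Fintype κ] (G : Matrix (Fin k) ι F) (H : Matrix (Fin k) κ F) :
    Matrix.fromCols G H * (Matrix.fromCols G H)ᵀ = G * Gᵀ + H * Hᵀ := by
  rw [Matrix.transpose_fromCols, Matrix.fromCols_mul_fromRows]

end Generator

/-! ### Code parameters read off a generator matrix -/

section Parameters

variable {F : Type*} [Field F] [DecidableEq F] {k d n : ℕ} {ι κ : Type*} [Fintype ι] [Fintype κ]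

/-- `G` generates an LCD code with minimum weight `d`, provided that there is a nonzero word. -/
structure IsLCDGenerator (G : Matrix (Fin k) ι F) (d : ℕ) : Prop where
  isUnit_gram : IsUnit (G * Gᵀ)
  le_weight : ∀ a, a ≠ 0 → d ≤ hammingNorm (a ᵥ* G)
  exists_weight : ∃ a, a ≠ 0 ∧ hammingNorm (a ᵥ* G) = d

theorem le_minWeight_iff {C : Submodule F (ι → F)} {e : ℕ∞} :
    e ≤ minWeight C ↔ ∀ c ∈ C, c ≠ 0 → e ≤ hammingNorm c := by
  simp only [minWeight, le_iInf_iff]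

theorem minWeight_eq_iff {C : Submodule F (ι → F)} :
    minWeight C = d ↔ (∀ c ∈ C, c ≠ 0 → d ≤ hammingNorm c) ∧
      ∃ c ∈ C, c ≠ 0 ∧ hammingNorm c = d := by
  constructor
  · intro h
    have h1 : ∀ c ∈ C, c ≠ 0 → d ≤ hammingNorm c := fun c hc h0 => by
      exact_mod_cast le_minWeight_iff.1 h.ge c hc h0
    refine ⟨h1, ?_⟩
    by_contra! hne
    -- If weight `d` were not attained, all nonzero weights would be at least `d + 1`; this also
    -- excludes the zero code, with `minWeight` equal to `⊤`.
    have h2 : ((d + 1 : ℕ) : ℕ∞) ≤ minWeight C := le_minWeight_iff.2 fun c hc h0 => by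
      exact_mod_cast (h1 c hc h0).lt_of_ne (hne c hc h0).symm
    rw [h] at h2
    norm_cast at h2
    omega
  · rintro ⟨h1, c, hc, h0, rfl⟩
    refine le_antisymm ?_ (le_minWeight_iff.2 fun c hc h0 => by exact_mod_cast h1 c hc h0)
    exact le_minWeight_iff.1 le_rfl c hc h0

theorem isLCDCode_iff {G : Matrix (Fin k) (Fin n) F} {C : Submodule F (Fin n → F)}
    (h : IsGeneratorMatrix G C) : IsLCDCode n k d C ↔ IsLCDGenerator G d := by
  have hfin : Module.finrank F C = k := by
    rw [← h.2, finrank_span_eq_card h.1, Fintype.card_fin]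
  have h0 (a : Fin k → F) : a ᵥ* G ≠ 0 ↔ a ≠ 0 := by
    rw [not_iff_not]
    refine ⟨fun ha => h.vecMul_injective (by simpa using ha), ?_⟩
    rintro rfl
    exact Matrix.zero_vecMul G
  have hw : minWeight C = d ↔ (∀ a, a ≠ 0 → d ≤ hammingNorm (a ᵥ* G)) ∧
      ∃ a, a ≠ 0 ∧ hammingNorm (a ᵥ* G) = d := by
    simp [minWeight_eq_iff, mem_iff_of_isGeneratorMatrix h, h0]
  constructor
  · rintro ⟨-, h2, h3⟩
    exact ⟨(inf_dual_eq_bot_iff h).1 h3, (hw.1 h2).1, (hw.1 h2).2⟩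
  · rintro ⟨h1, h2, h3⟩
    exact ⟨hfin, hw.2 ⟨h2, h3⟩, (inf_dual_eq_bot_iff h).2 h1⟩

/-- The dual code is the kernel of `G *ᵥ ·`, so its words of weight one are the multiples of unit
vectors at zero columns. -/
theorem two_le_dualDistance_iff {G : Matrix (Fin k) ι F} {C : Submodule F (ι → F)}
    (h : IsGeneratorMatrix G C) : 2 ≤ dualDistance C ↔ ∀ i, G.col i ≠ 0 := by
  classical
  have hdual (x : ι → F) : x ∈ dual C ↔ G *ᵥ x = 0 := by
    have h1 : x ∈ dual C ↔ ∀ b, b ⬝ᵥ (G *ᵥ x) = 0 := by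
      constructor
      · intro hx b
        rw [Matrix.dotProduct_mulVec, dotProduct_comm]
        exact hx _ ((mem_iff_of_isGeneratorMatrix h).2 ⟨b, rfl⟩)
      · intro hx y hy
        obtain ⟨b, rfl⟩ := (mem_iff_of_isGeneratorMatrix h).1 hy
        rw [dotProduct_comm, ← Matrix.dotProduct_mulVec]
        exact hx b
    rw [h1, ← dotProduct_eq_zero_iff]
    simp only [dotProduct_comm]
  rw [dualDistance, le_minWeight_iff]
  constructor
  · intro hC i hi
    have := hC (Pi.single i 1) ((hdual _).2 (by rw [Matrix.mulVec_single_one]; exact hi)) (by simp)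
    rw [hammingNorm, show ({j | (Pi.single i 1 : ι → F) j ≠ 0} : Finset ι) = {i} by
      ext j; by_cases hj : j = i <;> simp [hj], Finset.card_singleton] at this
    norm_num at this
  · intro hG x hx h0
    by_contra! hlt
    have hlt' : hammingNorm x ≤ 1 := by
      have : hammingNorm x < 2 := by exact_mod_cast hlt
      omega
    obtain ⟨i, hi⟩ := Function.ne_iff.1 h0
    have hx1 : x = Pi.single i (x i) := by
      ext j
      by_cases hj : j = i
      · subst hj; simp
      · rw [Pi.single_eq_of_ne hj]
        by_contra hne
        exact hj (Finset.card_le_one.1 hlt' j (by simpa using hne) i (by simpa using hi))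
    have h2 := (hdual x).1 hx
    rw [hx1, Matrix.mulVec_single, op_smul_eq_smul] at h2
    exact hG i ((smul_eq_zero.1 h2).resolve_left hi)

theorem ColumnEquiv.hammingNorm_eq {G : Matrix (Fin k) ι F} {H : Matrix (Fin k) κ F}
    (h : ColumnEquiv G H) (a : Fin k → F) : hammingNorm (a ᵥ* G) = hammingNorm (a ᵥ* H) := by
  obtain ⟨σ, hσ⟩ := h
  refine Finset.card_equiv σ fun i => ?_
  obtain ⟨c, hc⟩ := hσ i
  have : (a ᵥ* H) (σ i) = c * (a ᵥ* G) i := by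
    change a ⬝ᵥ H.col (σ i) = c * (a ⬝ᵥ G.col i)
    rw [hc, Units.smul_def, dotProduct_smul, smul_eq_mul]
  simp [this]

theorem ColumnEquiv.isLCDGenerator_iff {G : Matrix (Fin k) ι F} {H : Matrix (Fin k) κ F}
    (hF : ∀ c : Fˣ, (c : F) * c = 1) (h : ColumnEquiv G H) :
    IsLCDGenerator G d ↔ IsLCDGenerator H d := by
  constructor
  · rintro ⟨h1, h2, h3⟩
    simp only [h.hammingNorm_eq] at h2 h3
    exact ⟨h.gram_eq hF ▸ h1, h2, h3⟩
  · rintro ⟨h1, h2, h3⟩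
    simp only [← h.hammingNorm_eq] at h2 h3
    exact ⟨h.gram_eq hF ▸ h1, h2, h3⟩

theorem hammingNorm_vecMul_fromCols (G : Matrix (Fin k) ι F) (H : Matrix (Fin k) κ F)
    (a : Fin k → F) : hammingNorm (a ᵥ* Matrix.fromCols G H) =
      hammingNorm (a ᵥ* G) + hammingNorm (a ᵥ* H) := by
  rw [Matrix.vecMul_fromCols]
  simp only [hammingNorm, Finset.card_filter, Fintype.sum_sum_type, Sum.elim_inl, Sum.elim_inr]
  congr!

end Parameters

/-! ### Simplex columns as representatives of projective points -/

section Simplex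

variable {F : Type*} [Field F] {k : ℕ} {ι : Type*}

noncomputable instance [Fintype F] : Fintype (SimplexColumn F k) := by
  classical
  exact inferInstanceAs (Fintype {v : Fin k → F // ∃ i, v i = 1 ∧ ∀ j < i, v j = 0})

theorem SimplexColumn.ne_zero (p : SimplexColumn F k) : p.1 ≠ 0 := by
  obtain ⟨i, hi, -⟩ := p.2
  intro h
  simp [h] at hi

theorem exists_smul_simplexColumn {v : Fin k → F} (hv : v ≠ 0) :
    ∃ (c : Fˣ) (p : SimplexColumn F k), c • p.1 = v := by
  obtain ⟨i, hi, hmin⟩ := WellFounded.has_min (wellFounded_lt (α := Fin k)) {i | v i ≠ 0}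
    (Function.ne_iff.1 hv)
  refine ⟨Units.mk0 (v i) hi, ⟨(v i)⁻¹ • v, i, inv_mul_cancel₀ hi, fun j hj => ?_⟩, ?_⟩
  · have : v j = 0 := by
      by_contra hne
      exact hmin j hne hj
    simp [this]
  · rw [Units.smul_mk0, smul_inv_smul₀ hi]

/-- Proportional vectors have the same leading position, and there the normalised entry 1 reveals
the scalar. -/
theorem smul_simplexColumn_inj {c c' : Fˣ} {p p' : SimplexColumn F k}
    (h : c • p.1 = c' • p'.1) : c = c' ∧ p = p' := by
  obtain ⟨i, hi, hlt⟩ := p.2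
  obtain ⟨i', hi', hlt'⟩ := p'.2
  have hval (j : Fin k) : (c : F) * p.1 j = c' * p'.1 j := congrFun h j
  have hii : i = i' := by
    rcases lt_trichotomy i i' with hl | hl | hl
    · have := hval i
      rw [hi, hlt' i hl, mul_zero, mul_one] at this
      exact absurd this c.ne_zero
    · exact hl
    · have := hval i'
      rw [hi', hlt i' hl, mul_zero, mul_one] at this
      exact absurd this.symm c'.ne_zero
  subst hii
  have hc : c = c' := by
    have := hval i
    rw [hi, hi', mul_one, mul_one] at this
    exact Units.ext this
  subst hc
  exact ⟨rfl, Subtype.ext (smul_left_cancel c h)⟩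

/-- Every nonzero vector is a unique multiple of a simplex column. -/
noncomputable def unitsProdSimplexColumnEquiv :
    Fˣ × SimplexColumn F k ≃ {v : Fin k → F // v ≠ 0} :=
  Equiv.ofBijective
    (fun x => ⟨x.1 • x.2.1, fun h => x.2.ne_zero ((smul_eq_zero_iff_eq x.1).1 h)⟩)
    ⟨fun x y h => by
      obtain ⟨h1, h2⟩ := smul_simplexColumn_inj (Subtype.ext_iff.1 h)
      exact Prod.ext h1 h2,
    fun v => by
      obtain ⟨c, p, h⟩ := exists_smul_simplexColumn v.2
      exact ⟨(c, p), Subtype.ext h⟩⟩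

theorem sum_eq_sum_simplexColumn [Fintype F] [DecidableEq F] {M : Type*} [AddCommMonoid M]
    (f : (Fin k → F) → M) :
    ∑ v, f v = f 0 + ∑ c : Fˣ, ∑ p : SimplexColumn F k, f (c • p.1) := by
  rw [← Fintype.sum_prod_type' (f := fun (c : Fˣ) (p : SimplexColumn F k) => f (c • p.1)),
    Fintype.sum_eq_add_sum_subtype_ne f 0]
  congr 1
  exact (Fintype.sum_equiv unitsProdSimplexColumnEquiv _ _ fun x => rfl).symm

theorem card_simplexColumn [Fintype F] :
    (Fintype.card F - 1) * Fintype.card (SimplexColumn F k) + 1 = Fintype.card F ^ k := by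
  classical
  have h := sum_eq_sum_simplexColumn (F := F) (k := k) fun _ => 1
  simp only [Finset.sum_const, Finset.card_univ, smul_eq_mul, mul_one, Fintype.card_units,
    Fintype.card_fun, Fintype.card_fin] at h
  rw [h, add_comm]

theorem card_simplexColumn_eq_qNumber [Fintype F] :
    Fintype.card (SimplexColumn F k) = qNumber (Fintype.card F) k := by
  have h := card_simplexColumn (F := F) (k := k)
  rw [qNumber, ← h, Nat.add_sub_cancel, Nat.mul_div_cancel_left]
  have := Fintype.one_lt_card (α := F)
  omega

theorem col_mul (A : Matrix (Fin k) (Fin k) F) (G : Matrix (Fin k) ι F) (i : ι) :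
    (A * G).col i = A *ᵥ G.col i := rfl

theorem columnMult_mul_copies_zero {A : Matrix (Fin k) (Fin k) F} (hA : IsUnit A) (s : ℕ) :
    columnMult (A * copies s (simplexMatrix F k)) (columnClass 0) = 0 := by
  have hempty : IsEmpty {i // columnClass ((A * copies s (simplexMatrix F k)).col i) =
      columnClass 0} := by
    rw [isEmpty_subtype]
    intro i
    rw [columnClass_eq_zero_iff, col_mul]
    intro h
    have h0 : (copies s (simplexMatrix F k)).col i = 0 :=
      Matrix.mulVec_injective_iff_isUnit.2 hA (h.trans (Matrix.mulVec_zero A).symm)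
    exact i.2.ne_zero h0
  exact Nat.card_of_isEmpty

theorem columnMult_mul_copies {A : Matrix (Fin k) (Fin k) F} (hA : IsUnit A) (s : ℕ)
    {v : Fin k → F} (hv : v ≠ 0) :
    columnMult (A * copies s (simplexMatrix F k)) (columnClass v) = s := by
  obtain ⟨w, rfl⟩ := Matrix.mulVec_surjective_iff_isUnit.2 hA v
  have hw : w ≠ 0 := by
    rintro rfl
    exact hv (Matrix.mulVec_zero A)
  obtain ⟨c, p, rfl⟩ := exists_smul_simplexColumn hw
  have key (i : Fin s × SimplexColumn F k) :
      columnClass ((A * copies s (simplexMatrix F k)).col i) = columnClass (A *ᵥ (c • p.1)) ↔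
        i.2 = p := by
    rw [columnClass_eq_iff, col_mul]
    change (∃ c' : Fˣ, c' • A *ᵥ (c • p.1) = A *ᵥ i.2.1) ↔ _
    constructor
    · rintro ⟨c', hc'⟩
      rw [← Matrix.mulVec_smul, smul_smul] at hc'
      have h := Matrix.mulVec_injective_iff_isUnit.2 hA hc'
      exact (smul_simplexColumn_inj (c' := 1) (h.trans (one_smul Fˣ _).symm)).2.symm
    · intro h
      refine ⟨c⁻¹, ?_⟩
      rw [← Matrix.mulVec_smul, inv_smul_smul, h]
  rw [columnMult, Nat.card_congr (Equiv.subtypeEquivRight key)]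
  have e : {i : Fin s × SimplexColumn F k // i.2 = p} ≃ Fin s :=
    ⟨fun i => i.1.1, fun j => ⟨(j, p), rfl⟩, fun ⟨⟨j, p'⟩, h⟩ => by subst h; rfl, fun _ => rfl⟩
  rw [Nat.card_congr e, Nat.card_fin]

theorem columnMult_mul_copies_eq [Fintype F] {A : Matrix (Fin k) (Fin k) F} (hA : IsUnit A)
    (s : ℕ) (x : ColumnClass F k) :
    columnMult (A * copies s (simplexMatrix F k)) x =
      columnMult (copies s (simplexMatrix F k)) x := by
  obtain ⟨v, rfl⟩ := columnClass_surjective x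
  rw [← Matrix.one_mul (copies s (simplexMatrix F k)), ← Matrix.mul_assoc, Matrix.mul_one]
  by_cases hv : v = 0
  · rw [hv, columnMult_mul_copies_zero hA, columnMult_mul_copies_zero isUnit_one]
  · rw [columnMult_mul_copies hA s hv, columnMult_mul_copies isUnit_one s hv]

/-- An invertible `A` permutes the projective points, so it fixes the simplex multiplicities, which
then cancel for the same `A` on both sides. -/
theorem codeEquiv_fromCols_copies_iff [Fintype F] {κ : Type*} [Fintype ι] [Fintype κ] (s : ℕ)
    {G : Matrix (Fin k) ι F} {H : Matrix (Fin k) κ F} {C C' D D'}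
    (hG : IsGeneratorMatrix G C) (hH : IsGeneratorMatrix H D)
    (hG' : IsGeneratorMatrix (Matrix.fromCols (copies s (simplexMatrix F k)) G) C')
    (hH' : IsGeneratorMatrix (Matrix.fromCols (copies s (simplexMatrix F k)) H) D') :
    CodeEquiv C' D' ↔ CodeEquiv C D := by
  rw [codeEquiv_iff_exists_columnEquiv hG hH, codeEquiv_iff_exists_columnEquiv hG' hH']
  refine exists_congr fun A => and_congr_right fun hA => ?_
  rw [columnEquiv_iff_columnMult, columnEquiv_iff_columnMult]
  refine forall_congr' fun x => ?_
  rw [Matrix.mul_fromCols, columnMult_fromCols, columnMult_fromCols,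
    columnMult_mul_copies_eq hA, Nat.add_left_cancel_iff]

end Simplex

/-! ### Parametrising an affine hyperplane -/

section Shear

variable {F : Type*} [Field F] {k : ℕ} {ι : Type*}

theorem exists_dotProduct_eq_one {b : Fin k → F} (hb : b ≠ 0) : ∃ u, b ⬝ᵥ u = 1 := by
  obtain ⟨i, hi⟩ := Function.ne_iff.1 hb
  exact ⟨Pi.single i (b i)⁻¹, by rw [dotProduct_single]; exact mul_inv_cancel₀ hi⟩

theorem exists_orthogonal_ne_zero (hk : 2 ≤ k) (a : Fin k → F) : ∃ u, u ≠ 0 ∧ a ⬝ᵥ u = 0 := by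
  by_cases h : a ⟨0, by omega⟩ = 0
  · exact ⟨Pi.single ⟨0, by omega⟩ 1, by simp, by simp [h]⟩
  · refine ⟨Pi.single ⟨0, by omega⟩ (-a ⟨1, by omega⟩) + Pi.single ⟨1, by omega⟩ (a ⟨0, by omega⟩),
      fun h0 => ?_, ?_⟩
    · have := congrFun h0 ⟨1, by omega⟩
      simp [h] at this
    · rw [dotProduct_add, dotProduct_single, dotProduct_single]
      ring

/-- The affine map along `u` onto the hyperplane `p ⬝ᵥ v = 1`, when `p ⬝ᵥ u = 1`. -/
def shear (p u w : Fin k → F) : Fin k → F := w - (p ⬝ᵥ w) • u + u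

/-- Written as an affine function of `w`, the product is constant exactly when `x = (x ⬝ᵥ u) • p`;
all counts below rest on this dichotomy. -/
theorem dotProduct_shear (p u w x : Fin k → F) :
    x ⬝ᵥ shear p u w = (x - (x ⬝ᵥ u) • p) ⬝ᵥ w + x ⬝ᵥ u := by
  simp only [shear, dotProduct_add, dotProduct_sub, sub_dotProduct, dotProduct_smul,
    smul_dotProduct, smul_eq_mul]
  ring

theorem dotProduct_shear_self {p u : Fin k → F} (h : p ⬝ᵥ u = 1) (w : Fin k → F) :
    p ⬝ᵥ shear p u w = 1 := by
  rw [dotProduct_shear, h, one_smul, sub_self, zero_dotProduct, zero_add]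

theorem columnMult_eq_sum [Fintype ι] [DecidableEq (ColumnClass F k)] (G : Matrix (Fin k) ι F)
    (x : ColumnClass F k) :
    columnMult G x = ∑ i, if columnClass (G.col i) = x then 1 else 0 := by
  rw [columnMult, Nat.card_eq_fintype_card, Fintype.card_subtype, Finset.card_filter]

theorem hammingNorm_eq_sum [DecidableEq F] [Fintype ι] (G : Matrix (Fin k) ι F) (a : Fin k → F) :
    hammingNorm (a ᵥ* G) = ∑ i, if G.col i ⬝ᵥ a ≠ 0 then 1 else 0 := by
  rw [hammingNorm, Finset.card_filter]
  refine Finset.sum_congr rfl fun i _ => ?_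
  rw [dotProduct_comm]
  rfl

end Shear

/-! ### Weight counts and the lower bound on multiplicities -/

section Counting

variable {F : Type*} [Field F] [Fintype F] [DecidableEq F] {k : ℕ} {ι : Type*} [Fintype ι]

/-- Translating `w` along a vector `u` with `b ⬝ᵥ u = 1` shifts the affine form through all of `F`.
Hence the count equals its average over the shifts, each `w` being nonzero for `q - 1` of them. -/
theorem card_affine_ne_zero {b : Fin k → F} (hb : b ≠ 0) (c : F) :
    Fintype.card F * Fintype.card {w : Fin k → F // b ⬝ᵥ w + c ≠ 0} =
      (Fintype.card F - 1) * Fintype.card F ^ k := by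
  obtain ⟨u, hu⟩ := exists_dotProduct_eq_one hb
  have htrans (t : F) : Fintype.card {w : Fin k → F // b ⬝ᵥ w + c ≠ 0} =
      ∑ w : Fin k → F, if b ⬝ᵥ w + c + t ≠ 0 then 1 else 0 := by
    rw [Fintype.card_subtype, Finset.card_filter]
    refine (Fintype.sum_equiv (Equiv.addRight (t • u)) _ _ fun w => ?_).symm
    simp only [Equiv.coe_addRight, dotProduct_add, dotProduct_smul, hu, smul_eq_mul, mul_one]
    rw [add_right_comm]
  have hcount (a : F) : ∑ t : F, (if a + t ≠ 0 then 1 else 0) = Fintype.card F - 1 := by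
    rw [← Finset.card_filter, ← Finset.card_univ, ← Finset.card_erase_of_mem (Finset.mem_univ (-a))]
    congr 1
    ext t
    simp [add_eq_zero_iff_neg_eq, eq_comm]
  calc _ = ∑ t : F, Fintype.card {w : Fin k → F // b ⬝ᵥ w + c ≠ 0} := by simp
    _ = ∑ t : F, ∑ w : Fin k → F, if b ⬝ᵥ w + c + t ≠ 0 then 1 else 0 :=
      Finset.sum_congr rfl fun t _ => htrans t
    _ = ∑ w : Fin k → F, ∑ t : F, if b ⬝ᵥ w + c + t ≠ 0 then 1 else 0 := Finset.sum_comm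
    _ = _ := by
      simp only [hcount, Finset.sum_const, Finset.card_univ, Fintype.card_fun, Fintype.card_fin,
        smul_eq_mul]
      rw [mul_comm]

theorem card_dotProduct_shear_of_proportional {p u x : Fin k → F} (hx : x ≠ 0)
    (h : x = (x ⬝ᵥ u) • p) :
    Fintype.card {w // x ⬝ᵥ shear p u w ≠ 0} = Fintype.card F ^ k := by
  have hxu : x ⬝ᵥ u ≠ 0 := by
    intro h0
    rw [h0, zero_smul] at h
    exact hx h
  have h' (w : Fin k → F) : x ⬝ᵥ shear p u w ≠ 0 := by
    rw [dotProduct_shear, sub_eq_zero.2 h, zero_dotProduct, zero_add]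
    exact hxu
  rw [Fintype.card_congr (Equiv.subtypeUnivEquiv h'), Fintype.card_fun, Fintype.card_fin]

theorem card_dotProduct_shear_of_not_proportional {p u x : Fin k → F}
    (h : x ≠ (x ⬝ᵥ u) • p) :
    Fintype.card F * Fintype.card {w // x ⬝ᵥ shear p u w ≠ 0} =
      (Fintype.card F - 1) * Fintype.card F ^ k := by
  simp only [dotProduct_shear]
  exact card_affine_ne_zero (sub_ne_zero.2 h) _

theorem le_card_dotProduct_shear {p u x : Fin k → F} (hx : x ≠ 0) :
    (Fintype.card F - 1) * Fintype.card F ^ k ≤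
      Fintype.card F * Fintype.card {w // x ⬝ᵥ shear p u w ≠ 0} := by
  by_cases h : x = (x ⬝ᵥ u) • p
  · rw [card_dotProduct_shear_of_proportional hx h]
    exact Nat.mul_le_mul_right _ (Nat.sub_le _ _)
  · exact (card_dotProduct_shear_of_not_proportional h).ge

/-- If all nonzero words have weight at least `d`, then every point occurs often as a column. -/
theorem le_columnMult {G : Matrix (Fin k) ι F} {d : ℕ}
    (hd : ∀ a, a ≠ 0 → d ≤ hammingNorm (a ᵥ* G)) {p : Fin k → F} (hp : p ≠ 0) :
    Fintype.card F * d + (Fintype.card F - 1) * columnMult G (columnClass 0) ≤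
      columnMult G (columnClass p) + (Fintype.card F - 1) * Fintype.card ι := by
  classical
  obtain ⟨u, hu⟩ := exists_dotProduct_eq_one hp
  set q := Fintype.card F with hq
  have hq1 : 1 < q := Fintype.one_lt_card
  -- The words `shear p u w` all have product 1 with `p`. A column proportional to `p` is nonzero on
  -- all of them, a zero column on none, any other on a fraction `(q-1)/q`. Summing over columns
  -- compares the total weight with `d` per word.
  have hcol (x : Fin k → F) : q * Fintype.card {w // x ⬝ᵥ shear p u w ≠ 0} +
      (q - 1) * q ^ k * (if columnClass x = columnClass 0 then 1 else 0) =
      q ^ k * (if columnClass x = columnClass p then 1 else 0) + (q - 1) * q ^ k := by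
    by_cases hx : x = 0
    · subst hx
      have : columnClass (0 : Fin k → F) ≠ columnClass p := fun h =>
        hp (columnClass_eq_zero_iff.1 h.symm)
      simp [this]
    · rw [if_neg (mt columnClass_eq_zero_iff.1 hx)]
      by_cases h : x = (x ⬝ᵥ u) • p
      · have hxu : x ⬝ᵥ u ≠ 0 := by
          intro h0
          rw [h0, zero_smul] at h
          exact hx h
        rw [if_pos (columnClass_eq_iff.2 ⟨Units.mk0 _ hxu, by rw [Units.smul_mk0]; exact h.symm⟩),
          card_dotProduct_shear_of_proportional hx h]
        obtain ⟨t, ht⟩ : ∃ t, q = t + 1 := ⟨q - 1, by omega⟩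
        rw [← hq, ht, Nat.add_sub_cancel]
        ring
      · rw [if_neg, card_dotProduct_shear_of_not_proportional h]
        · ring
        · rw [columnClass_eq_iff]
          rintro ⟨c, rfl⟩
          apply h
          rw [Units.smul_def, smul_dotProduct, hu, smul_eq_mul, mul_one]
  have hsum := Finset.sum_congr (rfl : (Finset.univ : Finset ι) = Finset.univ)
    fun i _ => hcol (G.col i)
  simp only [Finset.sum_add_distrib, ← Finset.mul_sum, ← columnMult_eq_sum, Finset.sum_const,
    Finset.card_univ, smul_eq_mul] at hsum
  have hswap : ∑ i, Fintype.card {w // G.col i ⬝ᵥ shear p u w ≠ 0} =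
      ∑ w, hammingNorm (shear p u w ᵥ* G) := by
    simp only [hammingNorm_eq_sum, Fintype.card_subtype, Finset.card_filter]
    exact Finset.sum_comm
  have hle : q ^ k * d ≤ ∑ w, hammingNorm (shear p u w ᵥ* G) := by
    have : ∑ _w : Fin k → F, d ≤ ∑ w, hammingNorm (shear p u w ᵥ* G) := by
      refine Finset.sum_le_sum fun w _ => hd _ fun h0 => ?_
      have := dotProduct_shear_self hu w
      rw [h0, dotProduct_zero] at this
      exact zero_ne_one this
    simpa using this
  rw [hswap] at hsum
  have hqk : 0 < q ^ k := by positivity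
  refine Nat.le_of_mul_le_mul_left ?_ hqk
  calc q ^ k * (q * d + (q - 1) * columnMult G (columnClass 0))
      = q * (q ^ k * d) + (q - 1) * q ^ k * columnMult G (columnClass 0) := by ring
    _ ≤ q * ∑ w, hammingNorm (shear p u w ᵥ* G) +
        (q - 1) * q ^ k * columnMult G (columnClass 0) :=
      Nat.add_le_add_right (Nat.mul_le_mul_left _ hle) _
    _ = _ := by rw [hsum]; ring

theorem hammingNorm_vecMul_copies (s : ℕ) {a : Fin k → F} (ha : a ≠ 0) :
    Fintype.card F * hammingNorm (a ᵥ* copies s (simplexMatrix F k)) =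
      s * Fintype.card F ^ k := by
  set q := Fintype.card F with hq
  have hq1 : 1 < q := Fintype.one_lt_card
  have h1 : hammingNorm (a ᵥ* copies s (simplexMatrix F k)) =
      s * ∑ p : SimplexColumn F k, if a ⬝ᵥ p.1 ≠ 0 then 1 else 0 := by
    rw [hammingNorm_eq_sum, Fintype.sum_prod_type]
    have (j : Fin s) (p : SimplexColumn F k) :
        (copies s (simplexMatrix F k)).col (j, p) ⬝ᵥ a = a ⬝ᵥ p.1 := dotProduct_comm _ _
    simp only [this, Finset.sum_const, Finset.card_univ, Fintype.card_fin, smul_eq_mul]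
  have h2 : Fintype.card {v : Fin k → F // a ⬝ᵥ v + 0 ≠ 0} =
      (q - 1) * ∑ p : SimplexColumn F k, if a ⬝ᵥ p.1 ≠ 0 then 1 else 0 := by
    -- Each projective point accounts for `q - 1` nonzero vectors.
    rw [Fintype.card_subtype, Finset.card_filter, sum_eq_sum_simplexColumn]
    simp [Units.smul_def, Fintype.card_units, hq]
  have h3 := card_affine_ne_zero ha 0
  rw [h2, ← hq, mul_left_comm] at h3
  have h4 := Nat.eq_of_mul_eq_mul_left (by omega : 0 < q - 1) h3
  rw [h1, mul_left_comm, h4]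

end Counting

/-! ### Self-orthogonality of the simplex and hyperplane blocks -/

section Gram

variable {F : Type*} [Field F] [Fintype F] {k : ℕ}

/-- A polynomial of total degree below `(q-1)k` sums to zero over `F^k`, as in the Chevalley–Warning
theorem. The bound `k₀` makes degree 2 small enough. -/
theorem sum_mul_eq_zero (h : 2 < (Fintype.card F - 1) * k) (i j : Fin k) :
    ∑ v : Fin k → F, v i * v j = 0 := by
  have := MvPolynomial.sum_eval_eq_zero (K := F) (MvPolynomial.X i * MvPolynomial.X j) (by
    refine (MvPolynomial.totalDegree_mul _ _).trans_lt ?_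
    simpa using h)
  simpa using this

/-- The simplex code is self-orthogonal. -/
theorem gram_copies (hF : ∀ c : Fˣ, (c : F) * c = 1) (h : 2 < (Fintype.card F - 1) * k) (s : ℕ) :
    copies s (simplexMatrix F k) * (copies s (simplexMatrix F k))ᵀ = 0 := by
  classical
  ext i j
  have h1 := sum_mul_eq_zero (F := F) h i j
  rw [sum_eq_sum_simplexColumn] at h1
  have h2 (c : Fˣ) (p : SimplexColumn F k) :
      (c • p.1) i * (c • p.1) j = p.1 i * p.1 j := by
    simp only [Pi.smul_apply, Units.smul_def, smul_eq_mul]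
    rw [mul_mul_mul_comm, hF, one_mul]
  simp only [h2, Pi.zero_apply, mul_zero, zero_add, Finset.sum_const, Finset.card_univ,
    Fintype.card_units, nsmul_eq_mul] at h1
  -- The sum over all vectors is `q - 1` times the sum over points, and `q - 1 = -1` in `F`.
  rw [Nat.cast_sub Fintype.card_pos, FiniteField.cast_card_eq_zero, Nat.cast_one, zero_sub,
    neg_one_mul, neg_eq_zero] at h1
  rw [Matrix.mul_apply, Fintype.sum_prod_type]
  exact Finset.sum_eq_zero fun _ _ => h1

/-- Replacing `w` by `w + u` leaves the sum of `(b ⬝ᵥ w) * f w` unchanged as a whole, yet adds the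
sum of `f` when `u ⬝ᵥ b = 1`. -/
theorem sum_eq_zero_of_translation_invariant {f : (Fin k → F) → F} {u : Fin k → F} (hu : u ≠ 0)
    (hf : ∀ w, f (w + u) = f w) : ∑ w, f w = 0 := by
  obtain ⟨b, hb⟩ := exists_dotProduct_eq_one hu
  have h : ∑ w, (b ⬝ᵥ w) * f w = ∑ w, ((b ⬝ᵥ w) * f w + f w) := by
    refine (Fintype.sum_equiv (Equiv.addRight u) _ _ fun w => ?_).symm
    rw [Equiv.coe_addRight, hf, dotProduct_add, dotProduct_comm b u, hb]
    ring
  rw [Finset.sum_add_distrib, left_eq_add] at h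
  exact h

/-- The matrix whose columns are the values of `shear p u`, `z` times each. -/
def shearMatrix (z : ℕ) (p u : Fin k → F) : Matrix (Fin k) (Fin z × (Fin k → F)) F :=
  Matrix.of fun i x => shear p u x.2 i

/-- The map `shear p u` is invariant under translation by `u`, hence so is each product of two of
its coordinates. -/
theorem gram_shearMatrix (z : ℕ) {p u : Fin k → F} (h : p ⬝ᵥ u = 1) :
    shearMatrix z p u * (shearMatrix z p u)ᵀ = 0 := by
  ext i j
  rw [Matrix.mul_apply, Fintype.sum_prod_type]
  refine Finset.sum_eq_zero fun _ _ => ?_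
  have hu : u ≠ 0 := by
    rintro rfl
    simp at h
  have hs (w : Fin k → F) : shear p u (w + u) = shear p u w := by
    simp only [shear, dotProduct_add, h, add_smul, one_smul]
    abel
  exact sum_eq_zero_of_translation_invariant (f := fun w => shear p u w i * shear p u w j) hu
    fun w => by simp only [hs]

theorem hammingNorm_vecMul_shearMatrix [DecidableEq F] (z : ℕ) (p u a : Fin k → F) :
    hammingNorm (a ᵥ* shearMatrix z p u) = z * Fintype.card {w // a ⬝ᵥ shear p u w ≠ 0} := by
  rw [hammingNorm_eq_sum, Fintype.sum_prod_type, Fintype.card_subtype, Finset.card_filter]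
  have (j : Fin z) (w : Fin k → F) : (shearMatrix z p u).col (j, w) ⬝ᵥ a = a ⬝ᵥ shear p u w :=
    dotProduct_comm _ _
  simp only [this, Finset.sum_const, Finset.card_univ, Fintype.card_fin, smul_eq_mul]

end Gram

/-! ### Passing between generator matrices and LCD codes -/

section Codes

variable {F : Type*} [Field F] {k n N d d₀ s : ℕ} {ι κ : Type*}

theorem ColumnEquiv.columns_ne_zero_iff [Finite ι] [Finite κ] {G : Matrix (Fin k) ι F} {H : Matrix (Fin k) κ F}
    (h : ColumnEquiv G H) : (∀ i, G.col i ≠ 0) ↔ ∀ j, H.col j ≠ 0 := by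
  rw [← columnMult_zero_eq_zero_iff, ← columnMult_zero_eq_zero_iff,
    columnEquiv_iff_columnMult.1 h]

theorem exists_reindex_columnEquiv [Fintype κ] (H : Matrix (Fin k) κ F) (h : Fintype.card κ = n) :
    ∃ G : Matrix (Fin k) (Fin n) F, ColumnEquiv G H :=
  ⟨H.submatrix id (Fintype.equivFinOfCardEq h).symm, (Fintype.equivFinOfCardEq h).symm,
    fun i => ⟨1, by rw [one_smul]; rfl⟩⟩

theorem ColumnEquiv.codeEquiv [Fintype ι] {G : Matrix (Fin k) ι F} {H : Matrix (Fin k) κ F} {C D}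
    (h : ColumnEquiv G H) (hG : IsGeneratorMatrix G C) (hH : IsGeneratorMatrix H D) :
    CodeEquiv C D :=
  (codeEquiv_iff_exists_columnEquiv hG hH).2 ⟨1, isUnit_one, by rwa [Matrix.one_mul]⟩

variable [DecidableEq F]

/-- The code generated by `G`, when it is LCD without zero coordinates. -/
def IsLCDGenerator.toCode {G : Matrix (Fin k) (Fin n) F} (h : IsLCDGenerator G d)
    (h0 : ∀ i, G.col i ≠ 0) : LCDCode F n k d :=
  have hG := isGeneratorMatrix_of_injective (vecMul_injective_of_isUnit_gram h.isUnit_gram)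
  ⟨_, (isLCDCode_iff hG).2 h, (two_le_dualDistance_iff hG).2 h0⟩

theorem IsLCDGenerator.isGeneratorMatrix [Fintype ι] {G : Matrix (Fin k) ι F} (h : IsLCDGenerator G d) :
    IsGeneratorMatrix G (Submodule.span F (Set.range G.row)) :=
  isGeneratorMatrix_of_injective (vecMul_injective_of_isUnit_gram h.isUnit_gram)

theorem LCDCode.exists_generator (C : LCDCode F n k d) :
    ∃ G : Matrix (Fin k) (Fin n) F,
      IsGeneratorMatrix G C.1 ∧ IsLCDGenerator G d ∧ ∀ i, G.col i ≠ 0 := by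
  obtain ⟨G, hG⟩ := exists_isGeneratorMatrix C.2.1.finrank_eq
  exact ⟨G, hG, (isLCDCode_iff hG).1 C.2.1, (two_le_dualDistance_iff hG).1 C.2.2⟩

/-- `C` is equivalent to the juxtaposition of `s` simplex codes and `C₀`. -/
def IsSimplexExtension (s : ℕ) (C : LCDCode F n k d) (C₀ : LCDCode F N k d₀) : Prop :=
  ∃ G₀ : Matrix (Fin k) (Fin N) F, IsGeneratorMatrix G₀ C₀.1 ∧
    ∃ D : Submodule F ((Fin s × SimplexColumn F k) ⊕ Fin N → F),
      IsGeneratorMatrix (Matrix.fromCols (copies s (simplexMatrix F k)) G₀) D ∧ CodeEquiv C.1 D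

theorem IsSimplexExtension.of_codeEquiv {C C' : LCDCode F n k d} {C₀ : LCDCode F N k d₀}
    (h : C ≈ C') (h' : IsSimplexExtension s C' C₀) : IsSimplexExtension s C C₀ := by
  obtain ⟨G, hG, D, hD, hCD⟩ := h'
  exact ⟨G, hG, D, hD, CodeEquiv.trans h hCD⟩

end Codes

/-! ### Adding and removing simplex copies -/

section Correspondence

variable {F : Type*} [Field F] [Fintype F] [DecidableEq F] {k n N d d₀ s : ℕ}
  {ι : Type*} [Fintype ι]

theorem isLCDGenerator_fromCols_copies_iff (hF : ∀ c : Fˣ, (c : F) * c = 1)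
    (hk : 2 < (Fintype.card F - 1) * k)
    (hd : Fintype.card F * d = s * Fintype.card F ^ k + Fintype.card F * d₀)
    {G : Matrix (Fin k) ι F} :
    IsLCDGenerator (Matrix.fromCols (copies s (simplexMatrix F k)) G) d ↔
      IsLCDGenerator G d₀ := by
  have hq : 0 < Fintype.card F := Fintype.card_pos
  have hgram := gram_fromCols (copies s (simplexMatrix F k)) G
  rw [gram_copies hF hk, zero_add] at hgram
  -- Every nonzero word has the same weight difference `d - d₀`, stated additively to avoid
  -- subtraction.
  have hw (a : Fin k → F) (ha : a ≠ 0) :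
      d + hammingNorm (a ᵥ* G) =
        hammingNorm (a ᵥ* Matrix.fromCols (copies s (simplexMatrix F k)) G) + d₀ := by
    have h := hammingNorm_vecMul_copies (F := F) s ha
    rw [hammingNorm_vecMul_fromCols]
    apply Nat.eq_of_mul_eq_mul_left hq
    rw [mul_add, mul_add, mul_add, h, hd]
    ring
  constructor
  · rintro ⟨h1, h2, a, ha, h3⟩
    refine ⟨hgram ▸ h1, fun b hb => ?_, a, ha, ?_⟩
    · have := h2 b hb
      have := hw b hb
      omega
    · have := hw a ha
      omega
  · rintro ⟨h1, h2, a, ha, h3⟩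
    refine ⟨hgram ▸ h1, fun b hb => ?_, a, ha, ?_⟩
    · have := h2 b hb
      have := hw b hb
      omega
    · have := hw a ha
      omega

theorem IsSimplexExtension.codeEquiv_iff {C C' : LCDCode F n k d} {C₀ C₀' : LCDCode F N k d₀}
    (h : IsSimplexExtension s C C₀) (h' : IsSimplexExtension s C' C₀') :
    C ≈ C' ↔ C₀ ≈ C₀' := by
  obtain ⟨G, hG, D, hD, hCD⟩ := h
  obtain ⟨G', hG', D', hD', hCD'⟩ := h'
  have key : CodeEquiv D D' ↔ CodeEquiv C₀.1 C₀'.1 :=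
    codeEquiv_fromCols_copies_iff s hG hG' hD hD'
  exact ⟨fun h => key.1 ((hCD.symm.trans h).trans hCD'),
    fun h => (hCD.trans (key.2 h)).trans hCD'.symm⟩

/-- With no zero columns, `le_columnMult` and `hs` give every point multiplicity at least `s`, so
`s` simplex copies can be split off. -/
theorem exists_isSimplexExtension_left (hF : ∀ c : Fˣ, (c : F) * c = 1)
    (hk : 2 < (Fintype.card F - 1) * k)
    (hd : Fintype.card F * d = s * Fintype.card F ^ k + Fintype.card F * d₀)
    (hn : n = s * qNumber (Fintype.card F) k + N)
    (hs : Fintype.card F * d = s + (Fintype.card F - 1) * n) (C : LCDCode F n k d) :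
    ∃ C₀ : LCDCode F N k d₀, IsSimplexExtension s C C₀ := by
  obtain ⟨G, hG, hGd, hG0⟩ := C.exists_generator
  have hle (x : ColumnClass F k) :
      columnMult (copies s (simplexMatrix F k)) x ≤ columnMult G x := by
    obtain ⟨v, rfl⟩ := columnClass_surjective x
    rw [← Matrix.one_mul (copies s (simplexMatrix F k))]
    by_cases hv : v = 0
    · rw [hv, columnMult_mul_copies_zero isUnit_one]
      exact Nat.zero_le _
    · rw [columnMult_mul_copies isUnit_one s hv]
      have h := le_columnMult hGd.le_weight hv
      rw [hs, columnMult_zero_eq_zero_iff.2 hG0, Fintype.card_fin] at h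
      omega
  obtain ⟨m, E, hm, hE⟩ := exists_complement_columns hle
  simp only [Nat.card_eq_fintype_card, Fintype.card_prod, Fintype.card_fin,
    card_simplexColumn_eq_qNumber] at hm
  obtain rfl : m = N := by omega
  have hGH : ColumnEquiv G (Matrix.fromCols (copies s (simplexMatrix F k)) E) :=
    columnEquiv_iff_columnMult.2 fun x => (hE x).trans (columnMult_fromCols _ _ x).symm
  have hHd := (hGH.isLCDGenerator_iff hF).1 hGd
  have hEd := (isLCDGenerator_fromCols_copies_iff hF hk hd).1 hHd
  have hE0 : ∀ i, E.col i ≠ 0 := fun i => hGH.columns_ne_zero_iff.1 hG0 (Sum.inr i)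
  exact ⟨hEd.toCode hE0, E, hEd.isGeneratorMatrix, _, hHd.isGeneratorMatrix,
    hGH.codeEquiv hG hHd.isGeneratorMatrix⟩

theorem exists_isSimplexExtension_right (hF : ∀ c : Fˣ, (c : F) * c = 1)
    (hk : 2 < (Fintype.card F - 1) * k)
    (hd : Fintype.card F * d = s * Fintype.card F ^ k + Fintype.card F * d₀)
    (hn : n = s * qNumber (Fintype.card F) k + N) (C₀ : LCDCode F N k d₀) :
    ∃ C : LCDCode F n k d, IsSimplexExtension s C C₀ := by
  obtain ⟨G, hG, hGd, hG0⟩ := C₀.exists_generator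
  have hHd : IsLCDGenerator (Matrix.fromCols (copies s (simplexMatrix F k)) G) d :=
    (isLCDGenerator_fromCols_copies_iff hF hk hd).2 hGd
  obtain ⟨K, hK⟩ := exists_reindex_columnEquiv (n := n)
    (Matrix.fromCols (copies s (simplexMatrix F k)) G) (by
      rw [Fintype.card_sum, Fintype.card_prod, Fintype.card_fin, Fintype.card_fin,
        card_simplexColumn_eq_qNumber, hn])
  have hKd := (hK.isLCDGenerator_iff hF).2 hHd
  refine ⟨hKd.toCode (hK.columns_ne_zero_iff.2 ?_), G, hG, _, hHd.isGeneratorMatrix,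
    hK.codeEquiv hKd.isGeneratorMatrix hHd.isGeneratorMatrix⟩
  rintro (i | i)
  · exact i.2.ne_zero
  · exact hG0 i

/-- Zero columns can be traded for nonzero ones after removing simplex codes. -/
theorem exists_lcdCode_of_isLCDGenerator (hF : ∀ c : Fˣ, (c : F) * c = 1)
    (hk : 2 < (Fintype.card F - 1) * k) (hk2 : 2 ≤ k)
    (hd : Fintype.card F * d = s * Fintype.card F ^ k + Fintype.card F * d₀)
    (hn : n = s * qNumber (Fintype.card F) k + N)
    (hs : Fintype.card F * d = s + (Fintype.card F - 1) * n)
    {G : Matrix (Fin k) (Fin n) F} (hG : IsLCDGenerator G d) :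
    Nonempty (LCDCode F N k d₀) := by
  classical
  set q := Fintype.card F with hq
  set z := columnMult G (columnClass 0) with hz
  -- This is the lower bound that `le_columnMult` gives when there are `z` zero columns.
  set t := s + (q - 1) * z with ht
  let O : Matrix (Fin k) (Fin z) F := 0
  have hO (v : Fin k → F) : columnMult O (columnClass v) = if v = 0 then z else 0 := by
    have (i : Fin z) : columnClass (O.col i) = columnClass v ↔ v = 0 := by
      rw [eq_comm]
      exact columnClass_eq_zero_iff
    simp [columnMult_eq_sum, this]
  have hle (x : ColumnClass F k) :
      columnMult (Matrix.fromCols (copies t (simplexMatrix F k)) O) x ≤ columnMult G x := by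
    obtain ⟨v, rfl⟩ := columnClass_surjective x
    rw [columnMult_fromCols, hO, ← Matrix.one_mul (copies t (simplexMatrix F k))]
    by_cases hv : v = 0
    · rw [hv, columnMult_mul_copies_zero isUnit_one, if_pos rfl, zero_add]
    · rw [columnMult_mul_copies isUnit_one t hv, if_neg hv]
      have h := le_columnMult hG.le_weight hv
      rw [← hq, hs, ← hz, Fintype.card_fin] at h
      omega
  obtain ⟨m, E, hm, hE⟩ := exists_complement_columns hle
  simp only [Nat.card_eq_fintype_card, Fintype.card_sum, Fintype.card_prod, Fintype.card_fin] at hm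
  have hGH : ColumnEquiv G
      (Matrix.fromCols (Matrix.fromCols (copies t (simplexMatrix F k)) O) E) :=
    columnEquiv_iff_columnMult.2 fun x => (hE x).trans (columnMult_fromCols _ _ x).symm
  have hgram : G * Gᵀ = E * Eᵀ := by
    rw [hGH.gram_eq hF, gram_fromCols, gram_fromCols, gram_copies hF hk]
    simp [O]
  have hE0 : ∀ i, E.col i ≠ 0 := by
    rw [← columnMult_zero_eq_zero_iff]
    have := hE (columnClass 0)
    rw [columnMult_fromCols, hO, if_pos rfl] at this
    omega
  have hwG (a : Fin k → F) (ha : a ≠ 0) :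
      q * hammingNorm (a ᵥ* G) = t * q ^ k + q * hammingNorm (a ᵥ* E) := by
    rw [hGH.hammingNorm_eq, hammingNorm_vecMul_fromCols, hammingNorm_vecMul_fromCols, mul_add,
      mul_add, hammingNorm_vecMul_copies t ha, Matrix.vecMul_zero, hammingNorm_zero, mul_zero,
      add_zero]
  obtain ⟨a, ha, had⟩ := hG.exists_weight
  -- With `a ⬝ᵥ u = 0`, the minimum weight word `a` is not `(a ⬝ᵥ u) • p`, so the new block gives it
  -- exactly the weight lost with the `(q - 1) * z` extra simplex copies.
  obtain ⟨u, hu, hau⟩ := exists_orthogonal_ne_zero hk2 a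
  obtain ⟨p, hp⟩ := exists_dotProduct_eq_one hu
  rw [dotProduct_comm] at hp
  have hwK (b : Fin k → F) : q * hammingNorm (b ᵥ* Matrix.fromCols E (shearMatrix z p u)) =
      q * hammingNorm (b ᵥ* E) +
        z * (q * Fintype.card {w // b ⬝ᵥ shear p u w ≠ 0}) := by
    rw [hammingNorm_vecMul_fromCols, hammingNorm_vecMul_shearMatrix]
    ring
  have hq0 : 0 < q := Fintype.card_pos
  have htk : t * q ^ k = s * q ^ k + z * ((q - 1) * q ^ k) := by rw [ht]; ring
  have hKd : IsLCDGenerator (Matrix.fromCols E (shearMatrix z p u)) d₀ := by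
    refine ⟨?_, fun b hb => ?_, a, ha, ?_⟩
    · rw [gram_fromCols, gram_shearMatrix z hp, add_zero, ← hgram]
      exact hG.isUnit_gram
    · refine Nat.le_of_mul_le_mul_left ?_ hq0
      -- Any other nonzero word receives at least the weight it lost.
      have h1 := Nat.mul_le_mul_left z (le_card_dotProduct_shear (p := p) (u := u) hb)
      have h2 := Nat.mul_le_mul_left q (hG.le_weight b hb)
      rw [hwG b hb, htk, hd] at h2
      rw [← hq] at h1
      rw [hwK]
      omega
    · apply Nat.eq_of_mul_eq_mul_left hq0
      rw [hwK, card_dotProduct_shear_of_not_proportional (by rwa [hau, zero_smul]), ← hq]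
      have h2 := hwG a ha
      rw [had, htk, hd] at h2
      omega
  -- The `z` zero columns and `(q - 1) * z` simplex copies make up `z * q ^ k` columns, the size of
  -- the new block.
  have hcard : Fintype.card (Fin m ⊕ (Fin z × (Fin k → F))) = N := by
    have h1 := card_simplexColumn (F := F) (k := k)
    rw [← hq] at h1
    rw [Fintype.card_sum, Fintype.card_prod, Fintype.card_fun, Fintype.card_fin,
      Fintype.card_fin, Fintype.card_fin, ← hq, ← h1]
    rw [← card_simplexColumn_eq_qNumber, hm, ht] at hn
    have : (s + (q - 1) * z) * Fintype.card (SimplexColumn F k) + z =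
      s * Fintype.card (SimplexColumn F k) +
        z * ((q - 1) * Fintype.card (SimplexColumn F k) + 1) := by ring
    omega
  obtain ⟨K, hK⟩ := exists_reindex_columnEquiv (Matrix.fromCols E (shearMatrix z p u)) hcard
  refine ⟨((hK.isLCDGenerator_iff hF).2 hKd).toCode (hK.columns_ne_zero_iff.2 ?_)⟩
  rintro (i | i)
  · exact hE0 i
  · intro h0
    have h1 := dotProduct_shear_self hp i.2
    have h2 : shear p u i.2 = 0 := h0
    rw [h2, dotProduct_zero] at h1
    exact zero_ne_one h1

end Correspondence

/-- A relation that is total on both sides and matches the two equivalences is the graph of a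
bijection of quotients; `htrans` recovers the relation for arbitrary representatives. -/
theorem exists_quotient_equiv_of_rel {α β : Type*} [Setoid α] [Setoid β] {R : α → β → Prop}
    (hleft : ∀ a, ∃ b, R a b) (hright : ∀ b, ∃ a, R a b)
    (hiff : ∀ {a a' b b'}, R a b → R a' b' → (a ≈ a' ↔ b ≈ b'))
    (htrans : ∀ {a a' b}, a ≈ a' → R a' b → R a b) :
    ∃ e : Quotient ‹Setoid α› ≃ Quotient ‹Setoid β›,
      ∀ a b, e (Quotient.mk _ a) = Quotient.mk _ b ↔ R a b := by
  choose f hf using hleft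
  let g : Quotient ‹Setoid α› → Quotient ‹Setoid β› :=
    Quotient.map f fun a a' h => (hiff (hf a) (hf a')).1 h
  have hg : Function.Bijective g := by
    constructor
    · rintro ⟨a⟩ ⟨a'⟩ h
      exact Quotient.sound ((hiff (hf a) (hf a')).2 (Quotient.exact h))
    · rintro ⟨b⟩
      obtain ⟨a, ha⟩ := hright b
      exact ⟨Quotient.mk _ a, Quotient.sound ((hiff (hf a) ha).1 (Setoid.refl a))⟩
  refine ⟨Equiv.ofBijective g hg, fun a b => ⟨fun h => ?_, fun h => ?_⟩⟩
  · obtain ⟨a', ha'⟩ := hright b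
    exact htrans ((hiff (hf a) ha').2 (Quotient.exact h)) ha'
  · exact Quotient.sound ((hiff (hf a) h).1 (Setoid.refl a))

/-- Weight, length and multiplicity bookkeeping, with the weight identity multiplied by `q` to avoid
`q^(k-1)`. The first two are multiples of `(q-1)[k]_q + 1 = q^k`. -/
theorem parameter_identities {q n k d r s : ℕ} (hq : 2 ≤ q) (hk : 1 ≤ k)
    (hQ : (q - 1) * qNumber q k + 1 = q ^ k)
    (hs : (s : ℤ) = (q : ℤ) * d - ((q : ℤ) - 1) * n) (hr : (r : ℤ) = rInt q n k d) :
    q * d = s * q ^ k + q * ((q - 1) * r) ∧ n = s * qNumber q k + q * r ∧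
      q * d = s + (q - 1) * n := by
  obtain ⟨t, rfl⟩ : ∃ t, q = t + 1 := ⟨q - 1, by omega⟩
  obtain ⟨l, rfl⟩ : ∃ l, k = l + 1 := ⟨k - 1, by omega⟩
  simp only [rInt, Nat.add_sub_cancel] at hr hQ ⊢
  generalize qNumber (t + 1) (l + 1) = K at *
  have hQ' : (t : ℤ) * K + 1 = (t + 1) ^ l * (t + 1) := by
    have := congrArg (Nat.cast : ℕ → ℤ) hQ
    push_cast at this
    rw [this, pow_succ]
  push_cast at hs hr
  refine ⟨?_, ?_, ?_⟩ <;> zify <;> rw [hs]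
  · rw [hr, pow_succ]
    linear_combination (((t : ℤ) + 1) * d) * hQ'
  · rw [hr]
    linear_combination (n : ℤ) * hQ'
  · ring

theorem units_mul_self_eq_one {F : Type*} [Field F] [Fintype F]
    (h : Fintype.card F = 2 ∨ Fintype.card F = 3) (c : Fˣ) : (c : F) * c = 1 := by
  have hc := FiniteField.pow_card_sub_one_eq_one (c : F) c.ne_zero
  rcases h with h | h <;> rw [h] at hc
  · rw [show (c : F) = 1 by simpa using hc, one_mul]
  · rw [← sq]
    exact hc

end LinCode

theorem mainTheorem1 {F : Type*} [Field F] [Fintype F] [DecidableEq F]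
    (q k₀ n k d r s : ℕ) (hF : Fintype.card F = q)
    (hq : (q = 2 ∧ k₀ = 3) ∨ (q = 3 ∧ k₀ = 2)) (hk : k₀ ≤ k)
    (hs : (s : ℤ) = (q : ℤ) * d - ((q : ℤ) - 1) * n) (hs1 : 1 ≤ s)
    (hr : (r : ℤ) = rInt q n k d) (hrk : k ≤ q * r) :
    (∃ e : LinCode.LCDClass F n k d ≃ LinCode.LCDClass F (q * r) k ((q - 1) * r),
      ∀ (C : LinCode.LCDCode F n k d) (C₀ : LinCode.LCDCode F (q * r) k ((q - 1) * r)),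
        e C.toClass = C₀.toClass ↔
          ∃ G₀ : Matrix (Fin k) (Fin (q * r)) F, LinCode.IsGeneratorMatrix G₀ C₀.1 ∧
            ∃ D : Submodule F ((Fin s × LinCode.SimplexColumn F k) ⊕ Fin (q * r) → F),
              LinCode.IsGeneratorMatrix
                (Matrix.fromCols (LinCode.copies s (LinCode.simplexMatrix F k)) G₀) D ∧
              LinCode.CodeEquiv C.1 D) ∧
    ((¬ ∃ C₀ : Submodule F (Fin (q * r) → F),
        LinCode.IsLCDCode (q * r) k ((q - 1) * r) C₀ ∧ 2 ≤ LinCode.dualDistance C₀) →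
      ¬ ∃ C : Submodule F (Fin n → F), LinCode.IsLCDCode n k d C) := by
  have hcard : Fintype.card F = 2 ∨ Fintype.card F = 3 := by omega
  have hF' := LinCode.units_mul_self_eq_one hcard
  subst hF
  have hk2 : 2 ≤ k := by omega
  have hk' : 2 < (Fintype.card F - 1) * k := by
    rcases hq with ⟨h, h₀⟩ | ⟨h, h₀⟩ <;> rw [h] <;> omega
  have hQ : (Fintype.card F - 1) * qNumber (Fintype.card F) k + 1 = Fintype.card F ^ k := by
    rw [← LinCode.card_simplexColumn_eq_qNumber]
    exact LinCode.card_simplexColumn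
  obtain ⟨hd, hn, hs'⟩ := LinCode.parameter_identities Fintype.one_lt_card (by omega) hQ hs hr
  refine ⟨LinCode.exists_quotient_equiv_of_rel (R := LinCode.IsSimplexExtension s)
    (LinCode.exists_isSimplexExtension_left hF' hk' hd hn hs')
    (LinCode.exists_isSimplexExtension_right hF' hk' hd hn)
    LinCode.IsSimplexExtension.codeEquiv_iff LinCode.IsSimplexExtension.of_codeEquiv, ?_⟩
  rintro hne ⟨C, hC⟩
  obtain ⟨G, hG⟩ := LinCode.exists_isGeneratorMatrix hC.finrank_eq
  obtain ⟨C₀⟩ := LinCode.exists_lcdCode_of_isLCDGenerator hF' hk' hk2 hd hn hs'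
    ((LinCode.isLCDCode_iff hG).1 hC)
  exact hne ⟨C₀.1, C₀.2⟩
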